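/- Let $k\ge 0$ be an integer and let $A,B,C,D$ be orthogonal projections on $\mathbb C^{2k+1}$ with $$A+B+C+D=\frac{4k+4}{2k+1}\,\mathbb I_{2k+1}.$$ Put $$x^{(1)}_\ell=\frac{4\ell+2}{2k+1},\quad x^{(2)}_\ell=\frac{4k-4\ell}{2k+1},\quad y^{(1)}_\ell=\frac{4\ell}{2k+1},\quad y^{(2)}_\ell=\frac{4k+2-4\ell}{2k+1},$$ and $$A_\ell=\frac12\begin{pmatrix}x^{(1)}_\ell&\sqrt{x^{(1)}_\ell x^{(2)}_\ell}\\ \sqrt{x^{(1)}_\ell x^{(2)}_\ell}&x^{(2)}_\ell\end{pmatrix},\quad B_\ell=\frac12\begin{pmatrix}x^{(1)}_\ell&-\sqrt{x^{(1)}_\ell x^{(2)}_\ell}\\ -\sqrt{x^{(1)}_\ell x^{(2)}_\ell}&x^{(2)}_\ell\end{pmatrix}\qquad(0\le\ell\le k-1),$$ $$C_\ell=\frac12\begin{pmatrix}y^{(1)}_\ell&\sqrt{y^{(1)}_\ell y^{(2)}_\ell}\\ \sqrt{y^{(1)}_\ell y^{(2)}_\ell}&y^{(2)}_\ell\end{pmatrix},\quad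 D_\ell=\frac12\begin{pmatrix}y^{(1)}_\ell&-\sqrt{y^{(1)}_\ell y^{(2)}_\ell}\\ -\sqrt{y^{(1)}_\ell y^{(2)}_\ell}&y^{(2)}_\ell\end{pmatrix}\qquad(1\le\ell\le k).$$ All these $2\times 2$ blocks are orthogonal projections, and there is an orthonormal basis $|0\rangle,\dots,|2k\rangle$ of $\mathbb C^{2k+1}$ in which, simultaneously, $$A=\bigoplus_{\ell=0}^{k-1}A_\ell\oplus E_{2k},\quad B=\bigoplus_{\ell=0}^{k-1}B_\ell\oplus E_{2k},\quad C=E_0\oplus\bigoplus_{\ell=1}^{k}C_\ell,\quad D=E_0\oplus\bigoplus_{\ell=1}^{k}D_\ell,$$ where $E_j=|j\rangle\langle j|$, the blocks $A_\ell$ and $B_\ell$ act on $\mathrm{span}\{|2\ell\rangle,|2\ell+1\rangle\}$, and the blocks $C_\ell$ and $D_\ell$ act on $\mathrm{span}\{|2\ell-1\rangle,|2\ell\rangle\}$. In particular, the diagonal entries of $A$ and $B$ at $|2k\rangle$, and those of $C$ and $D$ at $|0\rangle$, are equal to $1$. -/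

import Mathlib

noncomputable section

namespace FourProjections

/-- The matrix unit `|i⟩⟨j|` of size `n` (rows and columns are numbered from `0`). -/
def E (n i j : ℕ) : Matrix (Fin n) (Fin n) ℂ :=
  Matrix.of fun r c => if (r : ℕ) = i ∧ (c : ℕ) = j then 1 else 0

/-- The `2 × 2` matrix `M` placed on the span of `|i⟩, |i + 1⟩`, and zero elsewhere. -/
def blockAt (n i : ℕ) (M : Matrix (Fin 2) (Fin 2) ℂ) : Matrix (Fin n) (Fin n) ℂ :=
  ∑ a : Fin 2, ∑ b : Fin 2, M a b • E n (i + a) (i + b)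

/-- `x_ℓ^{(1)} = (4ℓ + 2) / (2k + 1)`. -/
def x₁ (k l : ℕ) : ℝ := (4 * (l : ℝ) + 2) / (2 * (k : ℝ) + 1)

/-- `x_ℓ^{(2)} = (4k - 4ℓ) / (2k + 1)`. -/
def x₂ (k l : ℕ) : ℝ := (4 * (k : ℝ) - 4 * (l : ℝ)) / (2 * (k : ℝ) + 1)

/-- `y_ℓ^{(1)} = 4ℓ / (2k + 1)`. -/
def y₁ (k l : ℕ) : ℝ := 4 * (l : ℝ) / (2 * (k : ℝ) + 1)

/-- `y_ℓ^{(2)} = (4k + 2 - 4ℓ) / (2k + 1)`. -/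
def y₂ (k l : ℕ) : ℝ := (4 * (k : ℝ) + 2 - 4 * (l : ℝ)) / (2 * (k : ℝ) + 1)

/-- The block `½ (u, √(uv); √(uv), v)`. -/
def blockPlus (u v : ℝ) : Matrix (Fin 2) (Fin 2) ℂ :=
  (1 / 2 : ℂ) • !![(u : ℂ), (Real.sqrt (u * v) : ℂ); (Real.sqrt (u * v) : ℂ), (v : ℂ)]

/-- The block `½ (u, -√(uv); -√(uv), v)`. -/
def blockMinus (u v : ℝ) : Matrix (Fin 2) (Fin 2) ℂ :=
  (1 / 2 : ℂ) • !![(u : ℂ), -(Real.sqrt (u * v) : ℂ); -(Real.sqrt (u * v) : ℂ), (v : ℂ)]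

def blockA (k l : ℕ) : Matrix (Fin 2) (Fin 2) ℂ := blockPlus (x₁ k l) (x₂ k l)

def blockB (k l : ℕ) : Matrix (Fin 2) (Fin 2) ℂ := blockMinus (x₁ k l) (x₂ k l)

def blockC (k l : ℕ) : Matrix (Fin 2) (Fin 2) ℂ := blockPlus (y₁ k l) (y₂ k l)

def blockD (k l : ℕ) : Matrix (Fin 2) (Fin 2) ℂ := blockMinus (y₁ k l) (y₂ k l)

/-- `A_0 ⊕ ⋯ ⊕ A_{k-1} ⊕ 1`, with `A_ℓ` on the span of `|2ℓ⟩, |2ℓ+1⟩` and `1` on `|2k⟩`. -/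
def matA (k : ℕ) : Matrix (Fin (2 * k + 1)) (Fin (2 * k + 1)) ℂ :=
  ∑ l ∈ Finset.range k, blockAt (2 * k + 1) (2 * l) (blockA k l) + E (2 * k + 1) (2 * k) (2 * k)

/-- `B_0 ⊕ ⋯ ⊕ B_{k-1} ⊕ 1`, with `B_ℓ` on the span of `|2ℓ⟩, |2ℓ+1⟩` and `1` on `|2k⟩`. -/
def matB (k : ℕ) : Matrix (Fin (2 * k + 1)) (Fin (2 * k + 1)) ℂ :=
  ∑ l ∈ Finset.range k, blockAt (2 * k + 1) (2 * l) (blockB k l) + E (2 * k + 1) (2 * k) (2 * k)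

/-- `1 ⊕ C_1 ⊕ ⋯ ⊕ C_k`, with `1` on `|0⟩` and `C_ℓ` on the span of `|2ℓ-1⟩, |2ℓ⟩`
(here `1 ≤ ℓ`, so the subtraction is the genuine one). -/
def matC (k : ℕ) : Matrix (Fin (2 * k + 1)) (Fin (2 * k + 1)) ℂ :=
  E (2 * k + 1) 0 0 + ∑ l ∈ Finset.Icc 1 k, blockAt (2 * k + 1) (2 * l - 1) (blockC k l)

/-- `1 ⊕ D_1 ⊕ ⋯ ⊕ D_k`, with `1` on `|0⟩` and `D_ℓ` on the span of `|2ℓ-1⟩, |2ℓ⟩`. -/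
def matD (k : ℕ) : Matrix (Fin (2 * k + 1)) (Fin (2 * k + 1)) ℂ :=
  E (2 * k + 1) 0 0 + ∑ l ∈ Finset.Icc 1 k, blockAt (2 * k + 1) (2 * l - 1) (blockD k l)

end FourProjections

end

/-! For projections P, Q, the difference P - Q squares to 2(P+Q) - (P+Q)² and carries a
μ-eigenvector of P+Q to a (2-μ)-eigenvector, vanishing only for μ = 0 or 2. Put N = 2k+1. As C+D = 2
+ 2/N - (A+B), the spectrum of A+B lies in [2/N, 2]; A-B reflects it by μ ↦ 2-μ except at 2, and C-D
by μ ↦ 2+4/N-μ except at 2/N. The two reflections compose to a shift by 4/N, so finiteness forces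
2/N into the spectrum (`exists_eigenvector_bottom`). Climbing from 2/N by alternate normalised
reflections (`exists_linked`, `exists_adapted_seq`) gives 2k+1 unit eigenvectors with distinct
eigenvalues, hence an orthonormal basis. Each link yields one 2×2 block; the two ends of the chain
yield the entries 1. -/

namespace FourProjections

/-! ### Two projections: the reflection μ ↦ 2-μ -/

section TwoProjections

variable {V : Type*} [NormedAddCommGroup V] [InnerProductSpace ℂ V] {P Q : V →ₗ[ℂ] V}

theorem sub_apply_sub_apply (hP : P.IsSymmetricProjection) (hQ : Q.IsSymmetricProjection)
    {μ : ℝ} {v : V} (hv : (P + Q) v = (μ : ℂ) • v) :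
    (P - Q) ((P - Q) v) = ((μ * (2 - μ) : ℝ) : ℂ) • v := by
  have hPP : ∀ x, P (P x) = P x := fun x => LinearMap.congr_fun hP.isIdempotentElem.eq x
  have hQQ : ∀ x, Q (Q x) = Q x := fun x => LinearMap.congr_fun hQ.isIdempotentElem.eq x
  have h2 : (P + Q) ((P + Q) v) = ((μ * μ : ℝ) : ℂ) • v := by
    rw [hv, map_smul, hv, smul_smul]; push_cast; rfl
  have h3 : (P - Q) ((P - Q) v) = (2 : ℂ) • (P + Q) v - (P + Q) ((P + Q) v) := by
    simp only [LinearMap.sub_apply, LinearMap.add_apply, map_sub, map_add, hPP, hQQ]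
    module
  rw [h3, h2, hv]
  push_cast
  module

theorem add_apply_sub_apply (hP : P.IsSymmetricProjection) (hQ : Q.IsSymmetricProjection)
    {μ : ℝ} {v : V} (hv : (P + Q) v = (μ : ℂ) • v) :
    (P + Q) ((P - Q) v) = ((2 - μ : ℝ) : ℂ) • (P - Q) v := by
  have hPP : ∀ x, P (P x) = P x := fun x => LinearMap.congr_fun hP.isIdempotentElem.eq x
  have hQQ : ∀ x, Q (Q x) = Q x := fun x => LinearMap.congr_fun hQ.isIdempotentElem.eq x
  have h3 : (P + Q) ((P - Q) v) = (2 : ℂ) • (P - Q) v - (P - Q) ((P + Q) v) := by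
    simp only [LinearMap.sub_apply, LinearMap.add_apply, map_sub, map_add, hPP, hQQ]
    module
  rw [h3, hv, map_smul]
  push_cast
  module

theorem norm_sub_apply_sq (hP : P.IsSymmetricProjection) (hQ : Q.IsSymmetricProjection)
    {μ : ℝ} {v : V} (hv : (P + Q) v = (μ : ℂ) • v) :
    ‖(P - Q) v‖ ^ 2 = μ * (2 - μ) * ‖v‖ ^ 2 := by
  have h := (hP.isSymmetric.sub hQ.isSymmetric) ((P - Q) v) v
  rw [sub_apply_sub_apply hP hQ hv, inner_smul_left, inner_self_eq_norm_sq_to_K,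
    inner_self_eq_norm_sq_to_K, Complex.conj_ofReal] at h
  have h' : ((μ * (2 - μ) : ℝ) : ℂ) * (‖v‖ : ℂ) ^ 2 = (‖(P - Q) v‖ : ℂ) ^ 2 := h
  exact_mod_cast h'.symm

theorem eigenvalue_mem_Icc (hP : P.IsSymmetricProjection) (hQ : Q.IsSymmetricProjection)
    {μ : ℝ} {v : V} (hv0 : v ≠ 0) (hv : (P + Q) v = (μ : ℂ) • v) : 0 ≤ μ ∧ μ ≤ 2 := by
  have h := norm_sub_apply_sq hP hQ hv
  have hn : 0 < ‖v‖ ^ 2 := by positivity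
  have h0 : 0 ≤ μ * (2 - μ) := nonneg_of_mul_nonneg_left (h ▸ sq_nonneg _) hn
  constructor <;> nlinarith

theorem sub_apply_ne_zero (hP : P.IsSymmetricProjection) (hQ : Q.IsSymmetricProjection)
    {μ : ℝ} {v : V} (hv0 : v ≠ 0) (hv : (P + Q) v = (μ : ℂ) • v) (h0 : μ ≠ 0) (h2 : μ ≠ 2) :
    (P - Q) v ≠ 0 := by
  intro h
  have := sub_apply_sub_apply hP hQ hv
  rw [h, map_zero, eq_comm, smul_eq_zero] at this
  have h2' : 2 - μ ≠ 0 := sub_ne_zero.2 h2.symm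
  rcases this with h | h
  · exact mul_ne_zero h0 h2' (by exact_mod_cast h)
  · exact hv0 h

theorem apply_of_eigenvalue_two (hP : P.IsSymmetricProjection) (hQ : Q.IsSymmetricProjection)
    {v : V} (hv : (P + Q) v = ((2 : ℝ) : ℂ) • v) : P v = v ∧ Q v = v := by
  have h := norm_sub_apply_sq hP hQ hv
  simp only [sub_self, mul_zero, zero_mul, ne_eq, OfNat.ofNat_ne_zero, not_false_eq_true,
    pow_eq_zero_iff, norm_eq_zero, LinearMap.sub_apply, sub_eq_zero] at h
  rw [LinearMap.add_apply, ← h] at hv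
  have : P v = v := by
    have h2 : (2 : ℂ) • P v = (2 : ℂ) • v := by rw [two_smul, hv]; norm_num
    exact smul_right_injective V (two_ne_zero (α := ℂ)) h2
  exact ⟨this, h ▸ this⟩

/-- The pair `P`, `Q` acts on `v, w` through the blocks `½ (μ, ±√(μν); ±√(μν), ν)`. -/
def Linked (P Q : V →ₗ[ℂ] V) (μ ν : ℝ) (v w : V) : Prop :=
  (P v = blockPlus μ ν 0 0 • v + blockPlus μ ν 1 0 • w ∧
    P w = blockPlus μ ν 0 1 • v + blockPlus μ ν 1 1 • w) ∧
  (Q v = blockMinus μ ν 0 0 • v + blockMinus μ ν 1 0 • w ∧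
    Q w = blockMinus μ ν 0 1 • v + blockMinus μ ν 1 1 • w)

/-- Take w = (P-Q)v / √(μν). Then P-Q swaps v and w up to the factor √(μν), and P, Q are half the
sum and difference of P+Q and P-Q. The positive normalisation fixes the phase of w, hence the signs
in the blocks. -/
theorem exists_linked (hP : P.IsSymmetricProjection) (hQ : Q.IsSymmetricProjection)
    {μ ν : ℝ} (h0 : 0 < μ) (h2 : 0 < ν) (hμν : μ + ν = 2) {v : V} (hv1 : ‖v‖ = 1)
    (hv : (P + Q) v = (μ : ℂ) • v) :
    ∃ w, ‖w‖ = 1 ∧ (P + Q) w = (ν : ℂ) • w ∧ Linked P Q μ ν v w := by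
  obtain rfl : ν = 2 - μ := by linarith
  set c : ℝ := √(μ * (2 - μ)) with hc
  have hc0 : 0 < c := Real.sqrt_pos.2 (mul_pos h0 h2)
  have hc0' : (c : ℂ) ≠ 0 := by exact_mod_cast hc0.ne'
  have hcc : c * c = μ * (2 - μ) := Real.mul_self_sqrt (mul_pos h0 h2).le
  obtain ⟨w, hw⟩ : ∃ w, w = (c : ℂ)⁻¹ • (P - Q) v := ⟨_, rfl⟩
  have hTv : (P - Q) v = (c : ℂ) • w := by rw [hw, smul_inv_smul₀ hc0']
  have hTw : (P - Q) w = (c : ℂ) • v := by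
    rw [hw, map_smul, sub_apply_sub_apply hP hQ hv, ← hcc, smul_smul]
    push_cast
    rw [inv_mul_cancel_left₀ hc0']
  have hSw : (P + Q) w = ((2 - μ : ℝ) : ℂ) • w := by
    rw [hw, map_smul, add_apply_sub_apply hP hQ hv, smul_comm]
  have hn : ‖w‖ = 1 := by
    have h := norm_sub_apply_sq hP hQ hv
    rw [hTv, norm_smul, hv1, Complex.norm_real, Real.norm_of_nonneg hc0.le, ← hcc] at h
    have h1 : ‖w‖ ^ 2 = 1 := by
      have : (c * c) * (‖w‖ ^ 2) = (c * c) * 1 := by linarith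
      exact mul_left_cancel₀ (by positivity) this
    exact (pow_eq_one_iff_of_nonneg (norm_nonneg w) two_ne_zero).1 h1
  have plus : ∀ x, P x = (1 / 2 : ℂ) • ((P + Q) x + (P - Q) x) := fun x => by
    simp only [LinearMap.sub_apply, LinearMap.add_apply]; module
  have minus : ∀ x, Q x = (1 / 2 : ℂ) • ((P + Q) x - (P - Q) x) := fun x => by
    simp only [LinearMap.sub_apply, LinearMap.add_apply]; module
  refine ⟨w, hn, hSw, ⟨?_, ?_⟩, ?_, ?_⟩
  · rw [plus, hv, hTv]; simp [blockPlus, ← hc]; module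
  · rw [plus, hSw, hTw]; simp [blockPlus, ← hc]; module
  · rw [minus, hv, hTv]; simp [blockMinus, ← hc]; module
  · rw [minus, hSw, hTw]; simp [blockMinus, ← hc]; module

end TwoProjections

/-! ### The 2×2 blocks and their direct sums -/

section Blocks

theorem isStarProjection_blockPlus {u v : ℝ} (hu : 0 ≤ u) (hv : 0 ≤ v) (h : u + v = 2) :
    IsStarProjection (blockPlus u v) := by
  have hs : (√(u * v) : ℂ) * √(u * v) = u * v := by
    exact_mod_cast Real.mul_self_sqrt (mul_nonneg hu hv)
  have hc : (u : ℂ) + v = 2 := by exact_mod_cast h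
  constructor
  · ext i j
    fin_cases i <;> fin_cases j <;>
      simp only [blockPlus, Matrix.mul_apply, Fin.sum_univ_two] <;> simp <;> grind
  · ext i j
    fin_cases i <;> fin_cases j <;> simp [blockPlus, Matrix.star_apply]

theorem isStarProjection_blockMinus {u v : ℝ} (hu : 0 ≤ u) (hv : 0 ≤ v) (h : u + v = 2) :
    IsStarProjection (blockMinus u v) := by
  have hs : (√(u * v) : ℂ) * √(u * v) = u * v := by
    exact_mod_cast Real.mul_self_sqrt (mul_nonneg hu hv)
  have hc : (u : ℂ) + v = 2 := by exact_mod_cast h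
  constructor
  · ext i j
    fin_cases i <;> fin_cases j <;>
      simp only [blockMinus, Matrix.mul_apply, Fin.sum_univ_two] <;> simp <;> grind
  · ext i j
    fin_cases i <;> fin_cases j <;> simp [blockMinus, Matrix.star_apply]

theorem blockAt_apply (n i : ℕ) (M : Matrix (Fin 2) (Fin 2) ℂ) (r c : Fin n) :
    blockAt n i M r c =
      (if (r : ℕ) = i ∧ (c : ℕ) = i then M 0 0 else 0) +
      (if (r : ℕ) = i ∧ (c : ℕ) = i + 1 then M 0 1 else 0) +
      ((if (r : ℕ) = i + 1 ∧ (c : ℕ) = i then M 1 0 else 0) +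
      (if (r : ℕ) = i + 1 ∧ (c : ℕ) = i + 1 then M 1 1 else 0)) := by
  simp [blockAt, E, Matrix.add_apply, Fin.sum_univ_two]

theorem sum_blockAt_apply_of_not_mem {n k d : ℕ} (M : ℕ → Matrix (Fin 2) (Fin 2) ℂ)
    {r c : Fin n} (hc : ∀ l < k, (c : ℕ) ≠ 2 * l + d ∧ (c : ℕ) ≠ 2 * l + d + 1) :
    (∑ l ∈ Finset.range k, blockAt n (2 * l + d) (M l)) r c = 0 := by
  rw [Matrix.sum_apply]
  refine Finset.sum_eq_zero fun l hl => ?_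
  have := hc l (Finset.mem_range.1 hl)
  simp [blockAt_apply, this]

theorem sum_blockAt_apply_left {n k d l : ℕ} (M : ℕ → Matrix (Fin 2) (Fin 2) ℂ)
    (hl : l < k) {r c : Fin n} (hc : (c : ℕ) = 2 * l + d) :
    (∑ l ∈ Finset.range k, blockAt n (2 * l + d) (M l)) r c =
      (if (r : ℕ) = 2 * l + d then M l 0 0 else 0) +
      (if (r : ℕ) = 2 * l + d + 1 then M l 1 0 else 0) := by
  rw [Matrix.sum_apply, Finset.sum_eq_single_of_mem l (Finset.mem_range.2 hl)]
  · simp [blockAt_apply, hc]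
  · intro m _ hm
    have h1 : (c : ℕ) ≠ 2 * m + d := by omega
    have h2 : (c : ℕ) ≠ 2 * m + d + 1 := by omega
    simp [blockAt_apply, h1, h2]

theorem sum_blockAt_apply_right {n k d l : ℕ} (M : ℕ → Matrix (Fin 2) (Fin 2) ℂ)
    (hl : l < k) {r c : Fin n} (hc : (c : ℕ) = 2 * l + d + 1) :
    (∑ l ∈ Finset.range k, blockAt n (2 * l + d) (M l)) r c =
      (if (r : ℕ) = 2 * l + d then M l 0 1 else 0) +
      (if (r : ℕ) = 2 * l + d + 1 then M l 1 1 else 0) := by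
  rw [Matrix.sum_apply, Finset.sum_eq_single_of_mem l (Finset.mem_range.2 hl)]
  · simp [blockAt_apply, hc]
  · intro m _ hm
    have h1 : (c : ℕ) ≠ 2 * m + d := by omega
    have h2 : (c : ℕ) ≠ 2 * m + d + 1 := by omega
    simp [blockAt_apply, h1, h2]

/-- A direct sum of `k` consecutive `2 × 2` blocks starting at `d ∈ {0, 1}`, together with `1` at
the remaining index `e`. -/
theorem toMatrixOrthonormal_eq_sum_blockAt {V : Type*} [NormedAddCommGroup V]
    [InnerProductSpace ℂ V] [FiniteDimensional ℂ V] {k d e : ℕ}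
    (hde : d = 0 ∧ e = 2 * k ∨ d = 1 ∧ e = 0)
    (b : OrthonormalBasis (Fin (2 * k + 1)) ℂ V) {v : ℕ → V} (hb : ∀ i, b i = v i)
    (F : V →ₗ[ℂ] V) (M : ℕ → Matrix (Fin 2) (Fin 2) ℂ)
    (hM : ∀ l < k,
      F (v (2 * l + d)) = M l 0 0 • v (2 * l + d) + M l 1 0 • v (2 * l + d + 1) ∧
      F (v (2 * l + d + 1)) = M l 0 1 • v (2 * l + d) + M l 1 1 • v (2 * l + d + 1))
    (he : F (v e) = v e) :
    LinearMap.toMatrixOrthonormal b F =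
      ∑ l ∈ Finset.range k, blockAt (2 * k + 1) (2 * l + d) (M l) + E (2 * k + 1) e e := by
  have hinner : ∀ (r : Fin (2 * k + 1)) (j : ℕ), j < 2 * k + 1 →
      inner ℂ (b r) (v j) = if (r : ℕ) = j then 1 else 0 := fun r j hj => by
    rw [← hb ⟨j, hj⟩, orthonormal_iff_ite.1 b.orthonormal]
    simp [Fin.ext_iff]
  ext r c
  rw [LinearMap.toMatrixOrthonormal_apply_apply, hb c, Matrix.add_apply]
  have hcl := c.2
  by_cases hce : (c : ℕ) = e
  · rw [sum_blockAt_apply_of_not_mem M (by intro l hl; omega), hce, he, hinner r e (by omega)]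
    simp [E, hce]
  -- The subtraction is genuine: if d = 1, then e = 0 and c ≠ e.
  · obtain ⟨l, hl, hc⟩ : ∃ l < k, (c : ℕ) = 2 * l + d ∨ (c : ℕ) = 2 * l + d + 1 :=
      ⟨(c - d) / 2, by omega, by omega⟩
    have hE : E (2 * k + 1) e e r c = 0 := by simp [E, hce]
    rw [hE, add_zero]
    rcases hc with hc | hc
    · rw [sum_blockAt_apply_left M hl hc, hc, (hM l hl).1, inner_add_right, inner_smul_right,
        inner_smul_right, hinner r _ (by omega), hinner r _ (by omega)]
      simp
    · rw [sum_blockAt_apply_right M hl hc, hc, (hM l hl).2, inner_add_right, inner_smul_right,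
        inner_smul_right, hinner r _ (by omega), hinner r _ (by omega)]
      simp

theorem sum_Icc_blockAt (n k : ℕ) (M : ℕ → Matrix (Fin 2) (Fin 2) ℂ) :
    ∑ l ∈ Finset.Icc 1 k, blockAt n (2 * l - 1) (M l) =
      ∑ l ∈ Finset.range k, blockAt n (2 * l + 1) (M (l + 1)) := by
  rw [← Finset.Ico_add_one_right_eq_Icc, Finset.sum_Ico_eq_sum_range]
  refine Finset.sum_congr (by simp) fun l _ => ?_
  rw [add_comm 1 l]
  rfl

end Blocks

/-! ### The eigenvalues along the chain -/

section Parameters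

theorem x₁_add_x₂ (k l : ℕ) : x₁ k l + x₂ k l = 2 := by
  unfold x₁ x₂; field_simp; ring

theorem y₁_add_y₂ (k l : ℕ) : y₁ k l + y₂ k l = 2 := by
  unfold y₁ y₂; field_simp; ring

theorem x₁_pos (k l : ℕ) : 0 < x₁ k l := by unfold x₁; positivity

theorem x₂_pos {k l : ℕ} (h : l < k) : 0 < x₂ k l := by
  have : (l : ℝ) < k := by exact_mod_cast h
  exact div_pos (by linarith) (by positivity)

theorem y₁_pos {k l : ℕ} (h : 1 ≤ l) : 0 < y₁ k l := by
  have : (1 : ℝ) ≤ l := by exact_mod_cast h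
  exact div_pos (by linarith) (by positivity)

theorem y₂_pos {k l : ℕ} (h : l ≤ k) : 0 < y₂ k l := by
  have : (l : ℝ) ≤ k := by exact_mod_cast h
  exact div_pos (by linarith) (by positivity)

/-- The eigenvalue of `A + B` on the `m`-th vector of the adapted basis. -/
noncomputable def eigen (k m : ℕ) : ℝ := if Even m then x₁ k (m / 2) else x₂ k (m / 2)

theorem eigen_even (k l : ℕ) : eigen k (2 * l) = x₁ k l := by simp [eigen]

theorem eigen_odd (k l : ℕ) : eigen k (2 * l + 1) = x₂ k l := by
  have : (2 * l + 1) / 2 = l := by omega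
  simp [eigen, this]

theorem eigen_injective (k : ℕ) : Function.Injective (eigen k) := by
  have hN : (2 * (k : ℝ) + 1) ≠ 0 := by positivity
  -- Equality would make 4l + 2 a multiple of 4.
  have key : ∀ l m : ℕ, x₁ k l ≠ x₂ k m := fun l m h => by
    unfold x₁ x₂ at h
    rw [div_left_inj' hN] at h
    have : (4 * l + 2 + 4 * m : ℤ) = 4 * k := by
      have : (4 * l + 2 + 4 * m : ℝ) = 4 * k := by linarith
      exact_mod_cast this
    omega
  intro m n h
  obtain ⟨a, rfl | rfl⟩ := m.even_or_odd' <;> obtain ⟨c, rfl | rfl⟩ := n.even_or_odd' <;>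
    simp only [eigen_even, eigen_odd] at h
  · unfold x₁ at h
    rw [div_left_inj' hN] at h
    have : (a : ℝ) = c := by linarith
    rw [Nat.cast_injective this]
  · exact (key _ _ h).elim
  · exact (key _ _ h.symm).elim
  · unfold x₂ at h
    rw [div_left_inj' hN] at h
    have : (a : ℝ) = c := by linarith
    rw [Nat.cast_injective this]

end Parameters

/-- Dependent choice for finitely many steps; beyond them the default `a` keeps the choice function
total. -/
theorem exists_seq_of_step {α : Type*} {n : ℕ} {p : ℕ → α → Prop} {r : ℕ → α → α → Prop} {a : α}
    (h0 : p 0 a) (hstep : ∀ m < n, ∀ x, p m x → ∃ y, p (m + 1) y ∧ r m x y) :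
    ∃ f : ℕ → α, (∀ m ≤ n, p m (f m)) ∧ ∀ m < n, r m (f m) (f (m + 1)) := by
  have h : ∀ m x, ∃ y, m < n → p m x → p (m + 1) y ∧ r m x y := fun m x => by
    by_cases hm : m < n ∧ p m x
    · obtain ⟨y, hy⟩ := hstep m hm.1 x hm.2
      exact ⟨y, fun _ _ => hy⟩
    · exact ⟨a, fun h1 h2 => (hm ⟨h1, h2⟩).elim⟩
  choose g hg using h
  have hp : ∀ m ≤ n, p m (Nat.rec (motive := fun _ => α) a g m) := fun m => by
    induction m with
    | zero => exact fun _ => h0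
    | succ m ih => exact fun hm => (hg m _ hm (ih (by omega))).1
  exact ⟨fun m => Nat.rec (motive := fun _ => α) a g m, hp,
    fun m hm => (hg m _ hm (hp m hm.le)).2⟩

/-! ### Four projections: building the chain -/

section FourProjections

variable {V : Type*} [NormedAddCommGroup V] [InnerProductSpace ℂ V] {k : ℕ} {A B C D : V →ₗ[ℂ] V}

theorem add_apply_of_sum_eq
    (hsum : A + B + C + D = ((4 * (k : ℂ) + 4) / (2 * (k : ℂ) + 1)) • LinearMap.id)
    {μ ν : ℝ} (hμν : μ + ν = (4 * (k : ℝ) + 4) / (2 * (k : ℝ) + 1)) {v : V} :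
    (A + B) v = (μ : ℂ) • v ↔ (C + D) v = (ν : ℂ) • v := by
  have h := LinearMap.congr_fun hsum v
  have hc : ((4 * (k : ℂ) + 4) / (2 * (k : ℂ) + 1)) = μ + ν := by
    rw [← Complex.ofReal_add, hμν]; push_cast; rfl
  rw [hc] at h
  simp only [LinearMap.add_apply, LinearMap.smul_apply, LinearMap.id_apply, add_smul] at h ⊢
  constructor
  · intro h'
    rw [h', add_assoc, add_right_inj] at h
    exact h
  · intro h'
    rw [add_assoc, h', add_left_inj] at h
    exact h

theorem exists_eigenvector_bottom [FiniteDimensional ℂ V] [Nontrivial V]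
    (hA : A.IsSymmetricProjection) (hB : B.IsSymmetricProjection)
    (hC : C.IsSymmetricProjection) (hD : D.IsSymmetricProjection)
    (hsum : A + B + C + D = ((4 * (k : ℂ) + 4) / (2 * (k : ℂ) + 1)) • LinearMap.id) :
    ∃ v : V, ‖v‖ = 1 ∧ (A + B) v = (eigen k 0 : ℂ) • v := by
  set N : ℝ := 2 * (k : ℝ) + 1 with hN
  have hN0 : 0 < N := by positivity
  let σ : ℝ → Prop := fun μ => ∃ v : V, v ≠ 0 ∧ (A + B) v = (μ : ℂ) • v
  have hlam : (4 * (k : ℝ) + 4) / N = 2 + 2 / N := by rw [hN]; field_simp; ring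
  have hCD : ∀ {μ : ℝ} {v : V}, (A + B) v = (μ : ℂ) • v ↔
      (C + D) v = ((2 + 2 / N - μ : ℝ) : ℂ) • v := fun {μ v} =>
    add_apply_of_sum_eq hsum (by rw [← hN, hlam]; ring)
  -- The lower bound is the bound 2 for C+D.
  have hle : ∀ {μ}, σ μ → 2 / N ≤ μ ∧ μ ≤ 2 := by
    rintro μ ⟨v, hv0, hv⟩
    have h1 := eigenvalue_mem_Icc hA hB hv0 hv
    have h2 := eigenvalue_mem_Icc hC hD hv0 (hCD.1 hv)
    exact ⟨by linarith [h2.2], h1.2⟩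
  have hpos : 0 < 2 / N := by positivity
  have hAB : ∀ {μ}, σ μ → μ ≠ 2 → σ (2 - μ) := by
    rintro μ ⟨v, hv0, hv⟩ h2
    have := (hle ⟨v, hv0, hv⟩).1
    exact ⟨_, sub_apply_ne_zero hA hB hv0 hv (by linarith) h2, add_apply_sub_apply hA hB hv⟩
  have hCD' : ∀ {μ}, σ μ → μ ≠ 2 / N → σ (2 + 4 / N - μ) := by
    rintro μ ⟨v, hv0, hv⟩ h2
    have := (hle ⟨v, hv0, hv⟩).2
    refine ⟨_, sub_apply_ne_zero hC hD hv0 (hCD.1 hv) (by linarith) (fun h => h2 (by linarith)),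
      hCD.2 ?_⟩
    rw [add_apply_sub_apply hC hD (hCD.1 hv)]
    congr 2
    ring
  have hstart : ∃ μ, σ μ := by
    have hS := hA.isSymmetric.add hB.isSymmetric
    have hd : 0 < Module.finrank ℂ V := Module.finrank_pos
    have := (hS.hasEigenvector_eigenvectorBasis rfl ⟨0, hd⟩)
    exact ⟨_, _, this.2, this.apply_eq_smul⟩
  have hbottom : σ (2 / N) := by
    by_contra hbot
    have htop : σ 2 := by
      by_contra htop
      obtain ⟨μ, hμ⟩ := hstart
      -- With neither exception available, the descent by 4/N never stops and violates the lower
      -- bound.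
      have hall : ∀ j : ℕ, σ (μ - j * (4 / N)) := fun j => by
        induction j with
        | zero => simpa using hμ
        | succ j ih =>
          have h1 := hCD' ih (fun h => hbot (h ▸ ih))
          have h2 := hAB h1 (fun h => htop (h ▸ h1))
          convert h2 using 1
          push_cast; ring
      obtain ⟨j, hj⟩ := exists_nat_gt (μ / (4 / N))
      rw [div_lt_iff₀ (by positivity)] at hj
      linarith [(hle (hall j)).1]
    -- Descending from 2, the value at j = k is exactly 2 - 4k/N = 2/N.
    have hall : ∀ j ≤ k, σ (2 - j * (4 / N)) := fun j => by
      induction j with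
      | zero => intro _; simpa using htop
      | succ j ih =>
        intro hj
        have ih := ih (by omega)
        have h1 := hCD' ih (fun h => hbot (h ▸ ih))
        have h2 := hAB h1 (fun h => ?_)
        · convert h2 using 1
          push_cast; ring
        -- The A-B reflection would be blocked only if 4(j+1)/N = 2, impossible modulo 4.
        · field_simp at h
          have h' : (4 * j + 4 : ℤ) = 2 * (2 * k + 1) := by
            have : (4 * j + 4 : ℝ) = 2 * (2 * k + 1) := by linarith
            exact_mod_cast this
          omega
    have h := hall k le_rfl
    apply hbot
    convert h using 1
    field_simp
    rw [hN]; ring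
  obtain ⟨v, hv0, hv⟩ := hbottom
  refine ⟨((‖v‖⁻¹ : ℝ) : ℂ) • v, ?_, ?_⟩
  · rw [norm_smul, Complex.norm_real, norm_inv, norm_norm, inv_mul_cancel₀ (norm_ne_zero_iff.2 hv0)]
  · rw [map_smul, hv, smul_comm]
    simp [eigen, x₁, hN]

theorem exists_adapted_seq [FiniteDimensional ℂ V] [Nontrivial V]
    (hA : A.IsSymmetricProjection) (hB : B.IsSymmetricProjection)
    (hC : C.IsSymmetricProjection) (hD : D.IsSymmetricProjection)
    (hsum : A + B + C + D = ((4 * (k : ℂ) + 4) / (2 * (k : ℂ) + 1)) • LinearMap.id) :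
    ∃ v : ℕ → V, (∀ m ≤ 2 * k, ‖v m‖ = 1 ∧ (A + B) (v m) = (eigen k m : ℂ) • v m) ∧
      (∀ l < k, Linked A B (x₁ k l) (x₂ k l) (v (2 * l)) (v (2 * l + 1))) ∧
      ∀ l < k, Linked C D (y₁ k (l + 1)) (y₂ k (l + 1)) (v (2 * l + 1)) (v (2 * l + 1 + 1)) := by
  obtain ⟨v₀, hv₀⟩ := exists_eigenvector_bottom hA hB hC hD hsum
  obtain ⟨v, h1, h2⟩ := exists_seq_of_step (n := 2 * k)
    (p := fun m v => ‖v‖ = 1 ∧ (A + B) v = (eigen k m : ℂ) • v)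
    (r := fun m v w => if Even m then Linked A B (x₁ k (m / 2)) (x₂ k (m / 2)) v w
      else Linked C D (y₁ k (m / 2 + 1)) (y₂ k (m / 2 + 1)) v w) hv₀ (by
    rintro m hm v ⟨hv1, hv⟩
    obtain ⟨l, rfl | rfl⟩ := m.even_or_odd'
    · rw [eigen_even] at hv
      obtain ⟨w, hw⟩ := exists_linked hA hB (x₁_pos k l) (x₂_pos (by omega)) (x₁_add_x₂ k l) hv1 hv
      exact ⟨w, ⟨hw.1, by rw [eigen_odd]; exact hw.2.1⟩, by simpa using hw.2.2⟩
    -- Odd steps use C-D: the complement of x₂ at l is y₁ at l+1, and below, that of x₁ at l+1 is y₂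
    -- at l+1.
    · rw [eigen_odd, add_apply_of_sum_eq hsum (ν := y₁ k (l + 1))
        (by unfold x₂ y₁; push_cast; field_simp; ring)] at hv
      obtain ⟨w, hw⟩ := exists_linked hC hD (y₁_pos (by omega)) (y₂_pos (by omega))
        (y₁_add_y₂ k (l + 1)) hv1 hv
      have : (2 * l + 1) / 2 = l := by omega
      refine ⟨w, ⟨hw.1, ?_⟩, by simpa [this] using hw.2.2⟩
      rw [show 2 * l + 1 + 1 = 2 * (l + 1) by ring, eigen_even,
        add_apply_of_sum_eq hsum (ν := y₂ k (l + 1))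
        (by unfold x₁ y₂; push_cast; field_simp; ring)]
      exact hw.2.1)
  refine ⟨v, h1, fun l hl => ?_, fun l hl => ?_⟩
  · simpa using h2 (2 * l) (by omega)
  · have : (2 * l + 1) / 2 = l := by omega
    simpa [this] using h2 (2 * l + 1) (by omega)

end FourProjections

end FourProjections

theorem mainTheorem10 (k : ℕ)
    (A B C D : EuclideanSpace ℂ (Fin (2 * k + 1)) →ₗ[ℂ] EuclideanSpace ℂ (Fin (2 * k + 1)))
    (hA : A.IsSymmetricProjection) (hB : B.IsSymmetricProjection)
    (hC : C.IsSymmetricProjection) (hD : D.IsSymmetricProjection)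
    (hsum : A + B + C + D = ((4 * (k : ℂ) + 4) / (2 * (k : ℂ) + 1)) • LinearMap.id) :
    (∀ l : ℕ, l < k → IsStarProjection (FourProjections.blockA k l) ∧
      IsStarProjection (FourProjections.blockB k l)) ∧
    (∀ l : ℕ, 1 ≤ l → l ≤ k → IsStarProjection (FourProjections.blockC k l) ∧
      IsStarProjection (FourProjections.blockD k l)) ∧
    ∃ b : OrthonormalBasis (Fin (2 * k + 1)) ℂ (EuclideanSpace ℂ (Fin (2 * k + 1))),
      LinearMap.toMatrixOrthonormal b A = FourProjections.matA k ∧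
      LinearMap.toMatrixOrthonormal b B = FourProjections.matB k ∧
      LinearMap.toMatrixOrthonormal b C = FourProjections.matC k ∧
      LinearMap.toMatrixOrthonormal b D = FourProjections.matD k ∧
      LinearMap.toMatrixOrthonormal b A (Fin.last (2 * k)) (Fin.last (2 * k)) = 1 ∧
      LinearMap.toMatrixOrthonormal b B (Fin.last (2 * k)) (Fin.last (2 * k)) = 1 ∧
      LinearMap.toMatrixOrthonormal b C 0 0 = 1 ∧
      LinearMap.toMatrixOrthonormal b D 0 0 = 1 := by
  refine ⟨fun l hl => ⟨FourProjections.isStarProjection_blockPlus ?_ ?_ ?_,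
      FourProjections.isStarProjection_blockMinus ?_ ?_ ?_⟩,
    fun l hl hlk => ⟨FourProjections.isStarProjection_blockPlus ?_ ?_ ?_,
      FourProjections.isStarProjection_blockMinus ?_ ?_ ?_⟩, ?_⟩
  · exact (FourProjections.x₁_pos k l).le
  · exact (FourProjections.x₂_pos hl).le
  · exact FourProjections.x₁_add_x₂ k l
  · exact (FourProjections.x₁_pos k l).le
  · exact (FourProjections.x₂_pos hl).le
  · exact FourProjections.x₁_add_x₂ k l
  · exact (FourProjections.y₁_pos hl).le
  · exact (FourProjections.y₂_pos hlk).le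
  · exact FourProjections.y₁_add_y₂ k l
  · exact (FourProjections.y₁_pos hl).le
  · exact (FourProjections.y₂_pos hlk).le
  · exact FourProjections.y₁_add_y₂ k l
  obtain ⟨v, hv, hAB, hCD⟩ := FourProjections.exists_adapted_seq hA hB hC hD hsum
  have hon : Orthonormal ℂ fun i : Fin (2 * k + 1) => v i := by
    refine ⟨fun i => (hv i (by omega)).1, fun i j hij => ?_⟩
    refine (hA.isSymmetric.add hB.isSymmetric).orthogonalFamily_eigenspaces
      (i := (FourProjections.eigen k i : ℂ)) (j := (FourProjections.eigen k j : ℂ)) ?_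
      ⟨_, Module.End.mem_eigenspace_iff.2 (hv i (by omega)).2⟩
      ⟨_, Module.End.mem_eigenspace_iff.2 (hv j (by omega)).2⟩
    intro h
    exact hij (Fin.ext (FourProjections.eigen_injective k (by exact_mod_cast h)))
  let b : OrthonormalBasis (Fin (2 * k + 1)) ℂ (EuclideanSpace ℂ (Fin (2 * k + 1))) :=
    OrthonormalBasis.mk hon
      (hon.linearIndependent.span_eq_top_of_card_eq_finrank (by simp)).ge
  have hb : ∀ i, b i = v i := fun i => by simp [b]
  have hN : (2 * (k : ℝ) + 1) ≠ 0 := by positivity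
  -- The chain ends at eigenvalue 2 of A+B; it starts at 2/N, which is eigenvalue 2 of C+D.
  have htop := FourProjections.apply_of_eigenvalue_two hA hB (v := v (2 * k)) (by
    rw [(hv (2 * k) le_rfl).2, FourProjections.eigen_even]
    congr 2
    unfold FourProjections.x₁; field_simp; ring)
  have hbot := FourProjections.apply_of_eigenvalue_two hC hD (v := v 0) (by
    refine (FourProjections.add_apply_of_sum_eq hsum ?_).1 (hv 0 (by omega)).2
    simp only [FourProjections.eigen, FourProjections.x₁]
    simp; field_simp; ring)
  have eA : LinearMap.toMatrixOrthonormal b A = FourProjections.matA k :=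
    FourProjections.toMatrixOrthonormal_eq_sum_blockAt (d := 0) (.inl ⟨rfl, rfl⟩) b hb A _
      (fun l hl => (hAB l hl).1) htop.1
  have eB : LinearMap.toMatrixOrthonormal b B = FourProjections.matB k :=
    FourProjections.toMatrixOrthonormal_eq_sum_blockAt (d := 0) (.inl ⟨rfl, rfl⟩) b hb B _
      (fun l hl => (hAB l hl).2) htop.2
  have eC : LinearMap.toMatrixOrthonormal b C = FourProjections.matC k := by
    rw [FourProjections.matC, FourProjections.sum_Icc_blockAt, add_comm (FourProjections.E _ _ _)]
    exact FourProjections.toMatrixOrthonormal_eq_sum_blockAt (.inr ⟨rfl, rfl⟩) b hb C _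
      (fun l hl => (hCD l hl).1) hbot.1
  have eD : LinearMap.toMatrixOrthonormal b D = FourProjections.matD k := by
    rw [FourProjections.matD, FourProjections.sum_Icc_blockAt, add_comm (FourProjections.E _ _ _)]
    exact FourProjections.toMatrixOrthonormal_eq_sum_blockAt (.inr ⟨rfl, rfl⟩) b hb D _
      (fun l hl => (hCD l hl).2) hbot.2
  have diag : ∀ (F : EuclideanSpace ℂ (Fin (2 * k + 1)) →ₗ[ℂ] EuclideanSpace ℂ (Fin (2 * k + 1)))
      (i : Fin (2 * k + 1)), F (v i) = v i → LinearMap.toMatrixOrthonormal b F i i = 1 :=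
    fun F i h => by
      rw [LinearMap.toMatrixOrthonormal_apply_apply, hb i, h, inner_self_eq_norm_sq_to_K,
        (hv i (by omega)).1]
      simp
  exact ⟨b, eA, eB, eC, eD, diag A _ htop.1, diag B _ htop.2, diag C 0 hbot.1, diag D 0 hbot.2⟩
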